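/- Let $\mathbb N=\{1,2,3,\dots\}$. A pattern is a subset of $\mathbb N\times\mathbb N$. A pattern $\mathcal P$ is called Schur bounded if every infinite complex matrix $X=[x_{ij}]_{i,j\in\mathbb N}$ with $|x_{ij}|\le 1$ for all $i,j$ and $x_{ij}=0$ for $(i,j)\notin\mathcal P$ is a bounded Schur multiplier, i.e. $T=[t_{ij}]\mapsto[x_{ij}t_{ij}]$ is a well-defined bounded linear map from $\mathcal B(\ell^2(\mathbb N))$ to itself, where $t_{ij}=\langle Te_j,e_i\rangle$. A pattern is row finite (respectively, column finite) if for some $k\in\mathbb N$ it has at most $k$ entries in each row (respectively, in each column). A finite or infinite set $\{s_1<s_2<\cdots\}\subset\mathbb N$ is lacunary if there is a constant $q>1$ such that $s_{i+1}/s_i>q$ for any two consecutive elements $s_i,s_{i+1}$ (so sets with at most one element are lacunary). Let $S\subset\mathbb N$, and let $\mathcal H(S)=\{(i,j)\in\mathbb N\times\mathbb N : i+j\in S\}$ be its Hankel pattern. Then the following are equivalent: 1. $\mathcal H(S)$ is Schur bounded. 2. $\mathcal H(S)$ is the union of a row finite set and a column finite set. 3. $\sup_{k\ge 0}|S\cap(2^{k-1},2^k]|<\infty$,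 where $k$ ranges over the integers $k\ge0$. 4. $S$ is the union of finitely many lacunary sets. -/

import Mathlib

/-- The complex Hilbert space `ℓ²` with index set the positive integers. -/
abbrev EllTwo : Type := lp (fun _ : ℕ+ => ℂ) 2

/-- The matrix entry `t_{ij} = ⟨T e_j, e_i⟩` of a bounded operator `T` on `ℓ²`,
with respect to the standard basis: the `i`-th coordinate of `T e_j`. -/
noncomputable def matrixEntry (T : EllTwo →L[ℂ] EllTwo) (i j : ℕ+) : ℂ :=
  (T (lp.single 2 j (1 : ℂ)) : EllTwo) i

/-- The infinite matrix `X` is a bounded Schur multiplier: `T = [t_{ij}] ↦ [x_{ij} t_{ij}]` is a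
well-defined bounded linear map from the bounded operators on `ℓ²` to themselves. -/
def IsBoundedSchurMultiplier (X : ℕ+ → ℕ+ → ℂ) : Prop :=
  ∃ Φ : (EllTwo →L[ℂ] EllTwo) →L[ℂ] (EllTwo →L[ℂ] EllTwo),
    ∀ (T : EllTwo →L[ℂ] EllTwo) (i j : ℕ+),
      matrixEntry (Φ T) i j = X i j * matrixEntry T i j

/-- The matrix `X` is supported on the pattern `P`. -/
def IsSupportedOn (X : ℕ+ → ℕ+ → ℂ) (P : Set (ℕ+ × ℕ+)) : Prop :=
  {p : ℕ+ × ℕ+ | X p.1 p.2 ≠ 0} ⊆ P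

/-- A pattern is Schur bounded if every matrix supported on it with entries of modulus at most `1`
is a bounded Schur multiplier. -/
def IsSchurBounded (P : Set (ℕ+ × ℕ+)) : Prop :=
  ∀ X : ℕ+ → ℕ+ → ℂ, IsSupportedOn X P → (∀ i j, ‖X i j‖ ≤ 1) → IsBoundedSchurMultiplier X

/-- At most `k` entries in each row. -/
def IsRowBounded (P : Set (ℕ+ × ℕ+)) (k : ℕ) : Prop :=
  ∀ i : ℕ+, {j : ℕ+ | (i, j) ∈ P}.encard ≤ k

/-- At most `k` entries in each column. -/
def IsColumnBounded (P : Set (ℕ+ × ℕ+)) (k : ℕ) : Prop :=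
  ∀ j : ℕ+, {i : ℕ+ | (i, j) ∈ P}.encard ≤ k

/-- Row finite means that a single bound works for all rows. -/
def IsRowFinite (P : Set (ℕ+ × ℕ+)) : Prop := ∃ k : ℕ, IsRowBounded P k

/-- Column finite means that a single bound works for all columns. -/
def IsColumnFinite (P : Set (ℕ+ × ℕ+)) : Prop := ∃ k : ℕ, IsColumnBounded P k

/-- The Hankel pattern of a set `S` of positive integers. -/
def hankelPattern (S : Set ℕ+) : Set (ℕ+ × ℕ+) := {p | p.1 + p.2 ∈ S}

/-- A (finite or infinite) set `S` of positive integers is lacunary if for some `q > 1` any two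
consecutive elements `s < t` of `S` satisfy `t / s > q`. -/
def IsLacunary (S : Set ℕ+) : Prop :=
  ∃ q : ℝ, 1 < q ∧ ∀ s ∈ S, ∀ t ∈ S, s < t → (∀ r ∈ S, ¬ (s < r ∧ r < t)) →
    q < ((t : ℕ) : ℝ) / ((s : ℕ) : ℝ)

/-- The part of `S` in the dyadic interval `(2^(k-1), 2^k]` of real numbers; the exponent `k - 1`
is an integer, so that the interval is `(1/2, 1]` for `k = 0`. -/
def dyadicPart (S : Set ℕ+) (k : ℕ) : Set ℕ+ :=
  {s ∈ S | (2 : ℝ) ^ ((k : ℤ) - 1) < ((s : ℕ) : ℝ) ∧ ((s : ℕ) : ℝ) ≤ (2 : ℝ) ^ k}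

/-! The dyadic condition is the hub: 3 → 2 → 1 → 3, and 3 ↔ 4.

If every dyadic interval holds at most K points of S, split the Hankel pattern along the diagonal.
For j ≤ i the sum i + j meets only two dyadic intervals, so each row has at most 2K such entries;
the other half is symmetric. A matrix of modulus at most 1 with k entries per row multiplies with
norm at most √k, by Cauchy–Schwarz and the ℓ² bound on columns of T; adjoints give the column
version (`isSchurBounded_union`).

Conversely, let S have n points in (2^m, 2^(m+1)]. In the rows (2^(m-1), 2^m] they give a block with
exactly n entries per row and at most n per column. Phases given by additive characters keep the
singular values of the block mostly of order √n (`exists_unimodular_fourth_moment_le`). A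
contraction T then pairs with the block to at least √n|I|/2, while a multiplier Φ allows at most
‖Φ‖√(|I||J|). Hence n ≤ 16‖Φ‖² (`card_le_norm_sq_of_schur`). The blocks occupy disjoint rows, so one
matrix X, and one Φ, serves all m. -/

/-! ### Schur multipliers on row finite and column finite patterns. -/

/-- A matrix with finitely supported rows whose partial actions are uniformly bounded by `C`
defines an operator of norm at most `C`. -/
theorem exists_operator_of_sum_le (a : ℕ+ → ℕ+ → ℂ) (F : ℕ+ → Finset ℕ+) (C : ℝ) (hC : 0 ≤ C)
    (h : ∀ (v : EllTwo) (s : Finset ℕ+),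
      ∑ i ∈ s, ‖∑ j ∈ F i, a i j * v j‖ ^ 2 ≤ (C * ‖v‖) ^ 2) :
    ∃ A : EllTwo →L[ℂ] EllTwo, ‖A‖ ≤ C ∧ ∀ (v : EllTwo) i, A v i = ∑ j ∈ F i, a i j * v j := by
  have hmem : ∀ v : EllTwo, Memℓp (E := fun _ : ℕ+ => ℂ) (fun i => ∑ j ∈ F i, a i j * v j) 2 :=
    fun v => memℓp_gen' (C := (C * ‖v‖) ^ 2) fun s => by simpa using h v s
  let A₀ : EllTwo →ₗ[ℂ] EllTwo :=
    { toFun := fun v => ⟨_, hmem v⟩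
      map_add' := fun v w => by
        ext i
        simp only [lp.coeFn_add, Pi.add_apply, mul_add, Finset.sum_add_distrib]
      map_smul' := fun c v => by
        ext i
        simp [Finset.mul_sum, mul_left_comm] }
  have hA₀ : ∀ v, ‖A₀ v‖ ≤ C * ‖v‖ := fun v =>
    lp.norm_le_of_forall_sum_le (by norm_num) (by positivity) fun s => by
      simpa [A₀] using h v s
  exact ⟨A₀.mkContinuous C hA₀, A₀.mkContinuous_norm_le hC _, fun v i => rfl⟩

theorem EllTwo.sum_sq_le_norm_sq (v : EllTwo) (s : Finset ℕ+) :
    ∑ i ∈ s, ‖v i‖ ^ 2 ≤ ‖v‖ ^ 2 := by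
  simpa using lp.sum_rpow_le_norm_rpow (p := 2) (by norm_num) v s

theorem sum_sq_matrixEntry_le (T : EllTwo →L[ℂ] EllTwo) (j : ℕ+) (s : Finset ℕ+) :
    ∑ i ∈ s, ‖matrixEntry T i j‖ ^ 2 ≤ ‖T‖ ^ 2 := by
  refine (EllTwo.sum_sq_le_norm_sq (T (lp.single 2 j (1 : ℂ))) s).trans ?_
  gcongr
  simpa [lp.norm_single] using T.le_opNorm (lp.single 2 j (1 : ℂ))

/-- Cauchy–Schwarz on the at most k terms of a row costs the factor k; after exchanging sums, each
column of T contributes at most ‖T‖². -/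
theorem sum_sq_schur_le {X : ℕ+ → ℕ+ → ℂ} (hX : ∀ i j, ‖X i j‖ ≤ 1) {F : ℕ+ → Finset ℕ+} {k : ℕ}
    (hF : ∀ i, (F i).card ≤ k) (T : EllTwo →L[ℂ] EllTwo) (v : EllTwo) (s : Finset ℕ+) :
    ∑ i ∈ s, ‖∑ j ∈ F i, X i j * matrixEntry T i j * v j‖ ^ 2 ≤
      (√k * ‖T‖ * ‖v‖) ^ 2 := by
  have hrow : ∀ i, ‖∑ j ∈ F i, X i j * matrixEntry T i j * v j‖ ^ 2 ≤
      k * ∑ j ∈ F i, ‖matrixEntry T i j‖ ^ 2 * ‖v j‖ ^ 2 := fun i => by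
    calc ‖∑ j ∈ F i, X i j * matrixEntry T i j * v j‖ ^ 2
        ≤ (∑ j ∈ F i, ‖matrixEntry T i j‖ * ‖v j‖) ^ 2 := by
          gcongr
          refine (norm_sum_le _ _).trans (Finset.sum_le_sum fun j _ => ?_)
          rw [norm_mul, norm_mul, mul_assoc]
          exact mul_le_of_le_one_left (by positivity) (hX i j)
      _ ≤ (F i).card * ∑ j ∈ F i, (‖matrixEntry T i j‖ * ‖v j‖) ^ 2 :=
          sq_sum_le_card_mul_sum_sq
      _ ≤ k * ∑ j ∈ F i, ‖matrixEntry T i j‖ ^ 2 * ‖v j‖ ^ 2 := by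
          simp only [mul_pow]
          gcongr
          exact hF i
  calc ∑ i ∈ s, ‖∑ j ∈ F i, X i j * matrixEntry T i j * v j‖ ^ 2
      ≤ ∑ i ∈ s, k * ∑ j ∈ s.biUnion F, ‖matrixEntry T i j‖ ^ 2 * ‖v j‖ ^ 2 := by
        refine Finset.sum_le_sum fun i hi => (hrow i).trans ?_
        gcongr
        exact Finset.subset_biUnion_of_mem F hi
    _ = k * ∑ j ∈ s.biUnion F, (∑ i ∈ s, ‖matrixEntry T i j‖ ^ 2) * ‖v j‖ ^ 2 := by
        rw [← Finset.mul_sum, Finset.sum_comm]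
        simp only [Finset.sum_mul]
    _ ≤ k * ∑ j ∈ s.biUnion F, ‖T‖ ^ 2 * ‖v j‖ ^ 2 := by
        gcongr with j
        exact sum_sq_matrixEntry_le T j s
    _ ≤ k * (‖T‖ ^ 2 * ‖v‖ ^ 2) := by
        rw [← Finset.mul_sum]
        gcongr
        exact EllTwo.sum_sq_le_norm_sq v _
    _ = (√k * ‖T‖ * ‖v‖) ^ 2 := by
        rw [mul_pow, mul_pow, Real.sq_sqrt (by positivity), mul_assoc]

theorem EllTwo.operator_ext {A B : EllTwo →L[ℂ] EllTwo} (h : ∀ v i, A v i = B v i) : A = B :=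
  ContinuousLinearMap.ext fun v => lp.ext (funext (h v))

theorem matrixEntry_eq_of_apply_eq {A : EllTwo →L[ℂ] EllTwo} {a : ℕ+ → ℕ+ → ℂ}
    {F : ℕ+ → Finset ℕ+} (hA : ∀ (v : EllTwo) i, A v i = ∑ j ∈ F i, a i j * v j)
    (ha : ∀ i j, j ∉ F i → a i j = 0) (i j : ℕ+) : matrixEntry A i j = a i j := by
  rw [matrixEntry, hA, Finset.sum_eq_single j]
  · simp
  · intro b _ hb
    simp [lp.single_apply, Pi.single_eq_of_ne hb]
  · intro hj
    simp [ha i j hj]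

theorem isBoundedSchurMultiplier_of_rowBounded {X : ℕ+ → ℕ+ → ℂ} (hX : ∀ i j, ‖X i j‖ ≤ 1)
    {R : Set (ℕ+ × ℕ+)} {k : ℕ} (hR : IsRowBounded R k) (hXR : IsSupportedOn X R) :
    IsBoundedSchurMultiplier X := by
  have hfin : ∀ i, {j : ℕ+ | (i, j) ∈ R}.Finite := fun i =>
    Set.finite_of_encard_le_coe (hR i)
  let F : ℕ+ → Finset ℕ+ := fun i => (hfin i).toFinset
  have hF : ∀ i, (F i).card ≤ k := fun i => by
    have := hR i
    rw [(hfin i).encard_eq_coe_toFinset_card] at this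
    exact_mod_cast this
  have hF0 : ∀ i j, j ∉ F i → X i j = 0 := fun i j hj => by
    by_contra hne
    exact hj ((hfin i).mem_toFinset.2 (hXR (a := (i, j)) hne))
  choose Φ hΦn hΦ using fun T : EllTwo →L[ℂ] EllTwo =>
    exists_operator_of_sum_le (fun i j => X i j * matrixEntry T i j) F (√k * ‖T‖) (by positivity)
      (sum_sq_schur_le hX hF T)
  let Φ₀ : (EllTwo →L[ℂ] EllTwo) →ₗ[ℂ] (EllTwo →L[ℂ] EllTwo) :=
    { toFun := Φ
      map_add' := fun S T => EllTwo.operator_ext fun v i => by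
        rw [add_apply, lp.coeFn_add, Pi.add_apply, hΦ, hΦ, hΦ,
          ← Finset.sum_add_distrib]
        refine Finset.sum_congr rfl fun j _ => ?_
        simp only [matrixEntry, add_apply, lp.coeFn_add, Pi.add_apply]
        ring
      map_smul' := fun c T => EllTwo.operator_ext fun v i => by
        rw [RingHom.id_apply, smul_apply, lp.coeFn_smul, Pi.smul_apply, hΦ, hΦ,
          smul_eq_mul, Finset.mul_sum]
        refine Finset.sum_congr rfl fun j _ => ?_
        simp only [matrixEntry, smul_apply, lp.coeFn_smul, Pi.smul_apply,
          smul_eq_mul]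
        ring }
  refine ⟨Φ₀.mkContinuous (√k) hΦn, fun T i j => ?_⟩
  exact matrixEntry_eq_of_apply_eq (hΦ T) (fun i j hj => by simp [hF0 i j hj]) i j

theorem matrixEntry_adjoint (T : EllTwo →L[ℂ] EllTwo) (i j : ℕ+) :
    matrixEntry (ContinuousLinearMap.adjoint T) i j = star (matrixEntry T j i) := by
  have key : ∀ (A : EllTwo →L[ℂ] EllTwo) (i j : ℕ+),
      matrixEntry A i j = inner ℂ (lp.single 2 i (1 : ℂ)) (A (lp.single 2 j (1 : ℂ))) :=
    fun A i j => by
      rw [lp.inner_single_left]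
      simp [matrixEntry]
  rw [key, key, ContinuousLinearMap.adjoint_inner_right]
  exact (inner_conj_symm _ _).symm

/-- The witness is T ↦ Φ(T*)*, linear because the two conjugate linear adjoints cancel. -/
theorem IsBoundedSchurMultiplier.of_star_transpose {X : ℕ+ → ℕ+ → ℂ}
    (h : IsBoundedSchurMultiplier fun i j => star (X j i)) : IsBoundedSchurMultiplier X := by
  obtain ⟨Φ, hΦ⟩ := h
  let Ψ : (EllTwo →L[ℂ] EllTwo) →ₗ[ℂ] (EllTwo →L[ℂ] EllTwo) :=
    { toFun := fun T => ContinuousLinearMap.adjoint (Φ (ContinuousLinearMap.adjoint T))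
      map_add' := fun S T => by simp only [map_add]
      map_smul' := fun c T => by
        rw [map_smulₛₗ, map_smul, map_smulₛₗ, RingHom.id_apply, starRingEnd_self_apply] }
  refine ⟨Ψ.mkContinuous ‖Φ‖ fun T => ?_, fun T i j => ?_⟩
  · have := Φ.le_opNorm (ContinuousLinearMap.adjoint T)
    simpa [Ψ] using this
  · change matrixEntry (ContinuousLinearMap.adjoint (Φ (ContinuousLinearMap.adjoint T))) i j = _
    rw [matrixEntry_adjoint, hΦ, matrixEntry_adjoint, star_mul', star_star, star_star]

theorem IsBoundedSchurMultiplier.add {X Y : ℕ+ → ℕ+ → ℂ} (hX : IsBoundedSchurMultiplier X)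
    (hY : IsBoundedSchurMultiplier Y) : IsBoundedSchurMultiplier fun i j => X i j + Y i j := by
  obtain ⟨Φ, hΦ⟩ := hX
  obtain ⟨Ψ, hΨ⟩ := hY
  refine ⟨Φ + Ψ, fun T i j => ?_⟩
  rw [add_mul, ← hΦ, ← hΨ]
  simp [matrixEntry]

theorem isSchurBounded_union {R C : Set (ℕ+ × ℕ+)} (hR : IsRowFinite R) (hC : IsColumnFinite C) :
    IsSchurBounded (R ∪ C) := by
  classical
  obtain ⟨k, hR⟩ := hR
  obtain ⟨l, hC⟩ := hC
  intro X hXs hX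
  have h1 : IsBoundedSchurMultiplier fun i j => if (i, j) ∈ R then X i j else 0 := by
    refine isBoundedSchurMultiplier_of_rowBounded (fun i j => ?_) hR fun p hp => ?_
    · split_ifs
      · exact hX i j
      · simp
    · by_contra h
      simp [h] at hp
  have h2 : IsBoundedSchurMultiplier fun i j => if (i, j) ∈ R then 0 else X i j := by
    refine IsBoundedSchurMultiplier.of_star_transpose ?_
    refine isBoundedSchurMultiplier_of_rowBounded (R := {p | (p.2, p.1) ∈ C}) (fun i j => ?_)
      (k := l) hC fun p hp => ?_
    · split_ifs
      · simp
      · simpa using hX j i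
    · by_cases h : (p.2, p.1) ∈ R
      · simp [h] at hp
      · have h3 : X p.2 p.1 ≠ 0 := by simpa [h] using hp
        exact (hXs (a := (p.2, p.1)) h3).resolve_left h
  convert h1.add h2 using 3 with i j
  split_ifs <;> simp

/-! ### Contractions with large trace pairing, and the upper bound for the pairing. -/

open scoped ComplexOrder in
/-- For every matrix `X`, the contraction `T = 2μ X (X*X + μ²)⁻¹` has a large trace pairing
with `X`. -/
theorem Matrix.exists_contraction_trace_ge {m n : Type*} [Fintype m] [Fintype n] [DecidableEq n]
    (X : Matrix m n ℂ) {μ : ℝ} (hμ : 0 < μ) :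
    ∃ T : Matrix m n ℂ, (1 - T.conjTranspose * T).PosSemidef ∧
      2 * μ * ((X.conjTranspose * X).trace.re / μ ^ 2 -
        (X.conjTranspose * X * (X.conjTranspose * X)).trace.re / μ ^ 4) ≤
      (X.conjTranspose * T).trace.re := by
  set B := X.conjTranspose * X with hB
  set c : ℂ := (μ : ℂ) with hc
  have hc0 : c ≠ 0 := Complex.ofReal_ne_zero.2 hμ.ne'
  have hcs : star c = c := Complex.conj_ofReal μ
  have hBs : B.conjTranspose = B := by simp [hB]
  have hApos : (B + c ^ 2 • (1 : Matrix n n ℂ)).PosDef := by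
    refine Matrix.PosDef.posSemidef_add (Matrix.posSemidef_conjTranspose_mul_self X) ?_
    refine Matrix.PosDef.one.smul ?_
    rw [hc]
    exact_mod_cast pow_pos hμ 2
  obtain ⟨D, hAD, hDA⟩ := isUnit_iff_exists.1 hApos.isUnit
  have hDs : D.conjTranspose = D := by
    have h1 : D.conjTranspose * (B + c ^ 2 • (1 : Matrix n n ℂ)) = 1 := by
      rw [← hApos.isHermitian.eq, ← Matrix.conjTranspose_mul, hAD, Matrix.conjTranspose_one]
    exact left_inv_eq_right_inv h1 hAD
  have hDB : D * B = 1 - c ^ 2 • D := by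
    rw [eq_sub_iff_add_eq, ← hDA, mul_add, Matrix.mul_smul, mul_one]
  have hBD : B * D = 1 - c ^ 2 • D := by
    rw [eq_sub_iff_add_eq, ← hAD, add_mul, Matrix.smul_mul, one_mul]
  refine ⟨(2 * c) • (X * D), ?_, ?_⟩
  -- On singular values: (σ² + μ²)² - 4μ²σ² = (σ² - μ²)², so 1 - T*T is a square.
  · have : 1 - ((2 * c) • (X * D)).conjTranspose * ((2 * c) • (X * D)) =
        ((B - c ^ 2 • (1 : Matrix n n ℂ)) * D).conjTranspose *
          ((B - c ^ 2 • (1 : Matrix n n ℂ)) * D) := by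
      have h1 : (B - c ^ 2 • (1 : Matrix n n ℂ)) * D = 1 - (2 * c ^ 2) • D := by
        rw [sub_mul, hBD, Matrix.smul_mul, one_mul, sub_sub, ← add_smul, two_mul]
      have h2 : (X * D).conjTranspose * (X * D) = D - c ^ 2 • (D * D) := by
        rw [Matrix.conjTranspose_mul, hDs, Matrix.mul_assoc, ← Matrix.mul_assoc X.conjTranspose,
          ← hB, hBD, mul_sub, mul_one, Matrix.mul_smul]
      rw [h1, Matrix.conjTranspose_smul, Matrix.smul_mul, Matrix.mul_smul, h2,
        Matrix.conjTranspose_sub, Matrix.conjTranspose_smul, Matrix.conjTranspose_one, hDs]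
      simp only [star_mul', star_pow, hcs, star_ofNat, sub_mul, mul_sub, one_mul, mul_one,
        Matrix.smul_mul, Matrix.mul_smul, smul_smul, smul_sub]
      module
    rw [this]
    exact Matrix.posSemidef_conjTranspose_mul_self _
  -- With b = σ², b/(b + μ²) exceeds b/μ² - b²/μ⁴ by b³/(μ⁴(b + μ²)). Expanding this by b + μ²
  -- splits it into two terms of the form Y*Y, whose traces are nonnegative.
  · have hM : B * D = (c ^ 2)⁻¹ • B - (c ^ 4)⁻¹ • (B * B) +
        ((c ^ 4)⁻¹ • ((B * B * D).conjTranspose * (B * B * D)) +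
          (c ^ 2)⁻¹ • ((X * B * D).conjTranspose * (X * B * D))) := by
      have h1 : (B * B * D).conjTranspose * (B * B * D) = B * B - (2 * c ^ 2) • B +
          (3 * c ^ 4) • 1 - (4 * c ^ 6) • D + c ^ 8 • (D * D) := by
        have : B * B * D = B - c ^ 2 • (1 : Matrix n n ℂ) + c ^ 4 • D := by
          rw [Matrix.mul_assoc, hBD, mul_sub, mul_one, Matrix.mul_smul, hBD]
          module
        rw [this]
        simp only [Matrix.conjTranspose_add, Matrix.conjTranspose_sub, Matrix.conjTranspose_smul,
          Matrix.conjTranspose_one, hDs, hBs, star_pow, hcs, add_mul, mul_add, sub_mul, mul_sub,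
          one_mul, mul_one, Matrix.smul_mul, Matrix.mul_smul, smul_smul, hDB, hBD]
        module
      have h2 : (X * B * D).conjTranspose * (X * B * D) = B - (2 * c ^ 2) • 1 +
          (3 * c ^ 4) • D - c ^ 6 • (D * D) := by
        have : (X * B * D).conjTranspose * (X * B * D) = D * B * B * (B * D) := by
          simp only [Matrix.conjTranspose_mul, hDs, hBs]
          simp only [hB, Matrix.mul_assoc]
        rw [this]
        simp only [sub_mul, mul_sub, one_mul, mul_one, Matrix.smul_mul, Matrix.mul_smul, smul_smul,
          hDB, hBD]
        module
      rw [h1, h2, hBD]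
      match_scalars <;> field_simp <;> ring
    have hpos : ∀ Y : Matrix m n ℂ, 0 ≤ (Y.conjTranspose * Y).trace.re := fun Y =>
      (Complex.le_def.1 (Matrix.posSemidef_conjTranspose_mul_self Y).trace_nonneg).1
    have hpos' : ∀ Y : Matrix n n ℂ, 0 ≤ (Y.conjTranspose * Y).trace.re := fun Y =>
      (Complex.le_def.1 (Matrix.posSemidef_conjTranspose_mul_self Y).trace_nonneg).1
    have hre : ∀ (r : ℝ) (z : ℂ), ((r : ℂ) * z).re = r * z.re :=
      Complex.re_ofReal_mul
    have hT : (X.conjTranspose * ((2 * c) • (X * D))).trace.re = 2 * μ * (B * D).trace.re := by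
      rw [Matrix.mul_smul, ← Matrix.mul_assoc, Matrix.trace_smul, smul_eq_mul, hc, ← hre]
      push_cast
      rfl
    have h2 : (c ^ 2)⁻¹ = (((μ ^ 2)⁻¹ : ℝ) : ℂ) := by push_cast; rfl
    have h4 : (c ^ 4)⁻¹ = (((μ ^ 4)⁻¹ : ℝ) : ℂ) := by push_cast; rfl
    rw [hT, hM, h2, h4]
    simp only [Matrix.trace_add, Matrix.trace_sub, Matrix.trace_smul, smul_eq_mul, Complex.add_re,
      Complex.sub_re, hre]
    have e1 := mul_nonneg (inv_nonneg.2 (pow_nonneg hμ.le 4)) (hpos' (B * B * D))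
    have e2 := mul_nonneg (inv_nonneg.2 (pow_nonneg hμ.le 2)) (hpos (X * B * D))
    gcongr
    rw [div_eq_inv_mul, div_eq_inv_mul]
    linarith

open scoped ComplexOrder in
theorem Matrix.sum_sq_mulVec_le {m n : Type*} [Fintype m] [Fintype n] [DecidableEq n]
    {T : Matrix m n ℂ} (hT : (1 - T.conjTranspose * T).PosSemidef) (v : n → ℂ) :
    ∑ i, ‖(T.mulVec v) i‖ ^ 2 ≤ ∑ j, ‖v j‖ ^ 2 := by
  have hsq : ∀ {k : Type _} [Fintype k] (w : k → ℂ),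
      (dotProduct (star w) w).re = ∑ i, ‖w i‖ ^ 2 := fun w => by
    simp only [dotProduct, Pi.star_apply, Complex.re_sum]
    refine Finset.sum_congr rfl fun i _ => ?_
    rw [RCLike.star_def, Complex.conj_mul', ← Complex.ofReal_pow, Complex.ofReal_re]
  have h1 := (Complex.le_def.1 (hT.dotProduct_mulVec_nonneg v)).1
  rw [Matrix.sub_mulVec, Matrix.one_mulVec, dotProduct_sub, ← Matrix.mulVec_mulVec,
    Matrix.dotProduct_mulVec, ← Matrix.star_mulVec, Complex.sub_re, Complex.zero_re, sub_nonneg,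
    hsq v] at h1
  refine le_trans (le_of_eq ?_) h1
  simp only [dotProduct, Pi.star_apply, Complex.re_sum]
  refine Finset.sum_congr rfl fun i _ => ?_
  rw [RCLike.star_def, Complex.conj_mul', ← Complex.ofReal_pow, Complex.ofReal_re]

/-- The trace moments become entrywise sums: tr X*X is the squared Hilbert–Schmidt norm of X, and tr
(X*X)² that of the Gram matrix of the columns. -/
theorem exists_contraction_pairing_ge (I J : Finset ℕ+) (x : ℕ+ → ℕ+ → ℂ) {μ : ℝ} (hμ : 0 < μ) :
    ∃ t : ℕ+ → ℕ+ → ℂ, (∀ i j, ¬ (i ∈ I ∧ j ∈ J) → t i j = 0) ∧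
      (∀ v : ℕ+ → ℂ, ∑ i ∈ I, ‖∑ j ∈ J, t i j * v j‖ ^ 2 ≤ ∑ j ∈ J, ‖v j‖ ^ 2) ∧
      2 * μ * ((∑ j ∈ J, ∑ i ∈ I, ‖x i j‖ ^ 2) / μ ^ 2 -
        (∑ j ∈ J, ∑ j' ∈ J, ‖∑ i ∈ I, star (x i j) * x i j'‖ ^ 2) / μ ^ 4) ≤
      (∑ j ∈ J, ∑ i ∈ I, star (x i j) * t i j).re := by
  classical
  let X : Matrix I J ℂ := fun i j => x i j
  obtain ⟨T, hT, hXT⟩ := X.exists_contraction_trace_ge hμ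
  let t : ℕ+ → ℕ+ → ℂ := fun i j => if h : i ∈ I ∧ j ∈ J then T ⟨i, h.1⟩ ⟨j, h.2⟩ else 0
  have ht : ∀ (i : I) (j : J), t i j = T i j := fun i j => by simp [t]
  refine ⟨t, fun i j h => dif_neg h, fun v => ?_, ?_⟩
  · have := Matrix.sum_sq_mulVec_le hT fun j => v j
    rw [← Finset.sum_coe_sort J, ← Finset.sum_coe_sort I]
    refine le_trans (le_of_eq (Finset.sum_congr rfl fun i _ => ?_)) this
    rw [← Finset.sum_coe_sort J]
    simp only [ht]
    rfl
  · have h1 : (X.conjTranspose * X).trace.re = ∑ j ∈ J, ∑ i ∈ I, ‖x i j‖ ^ 2 := by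
      simp only [Matrix.trace, Matrix.diag, Matrix.mul_apply, Matrix.conjTranspose_apply,
        Complex.re_sum]
      rw [← Finset.sum_coe_sort J]
      refine Finset.sum_congr rfl fun j _ => ?_
      rw [← Finset.sum_coe_sort I]
      refine Finset.sum_congr rfl fun i _ => ?_
      rw [RCLike.star_def, Complex.conj_mul', ← Complex.ofReal_pow, Complex.ofReal_re]
    have h2 : (X.conjTranspose * X * (X.conjTranspose * X)).trace.re =
        ∑ j ∈ J, ∑ j' ∈ J, ‖∑ i ∈ I, star (x i j) * x i j'‖ ^ 2 := by
      have hB : (X.conjTranspose * X).conjTranspose = X.conjTranspose * X := by simp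
      nth_rewrite 1 [← hB]
      simp only [Matrix.trace, Matrix.diag, Matrix.mul_apply (M := (X.conjTranspose * X).conjTranspose),
        Matrix.conjTranspose_apply (M := X.conjTranspose * X), Complex.re_sum]
      rw [Finset.sum_comm, ← Finset.sum_coe_sort J]
      refine Finset.sum_congr rfl fun j _ => ?_
      rw [← Finset.sum_coe_sort J]
      refine Finset.sum_congr rfl fun j' _ => ?_
      rw [RCLike.star_def, Complex.conj_mul', ← Complex.ofReal_pow, Complex.ofReal_re,
        Matrix.mul_apply, ← Finset.sum_coe_sort I]
      rfl
    have h3 : (X.conjTranspose * T).trace = ∑ j ∈ J, ∑ i ∈ I, star (x i j) * t i j := by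
      rw [← Finset.sum_coe_sort J]
      refine Finset.sum_congr rfl fun j _ => ?_
      rw [← Finset.sum_coe_sort I, Matrix.diag_apply, Matrix.mul_apply]
      simp only [ht]
      rfl
    rwa [h1, h2, h3] at hXT

/-- The double sum is the pairing of Φ(T) with the indicator vectors of J and I, for a contraction
T. -/
theorem norm_sum_schur_le {X : ℕ+ → ℕ+ → ℂ}
    {Φ : (EllTwo →L[ℂ] EllTwo) →L[ℂ] (EllTwo →L[ℂ] EllTwo)}
    (hΦ : ∀ (T : EllTwo →L[ℂ] EllTwo) (i j : ℕ+),
      matrixEntry (Φ T) i j = X i j * matrixEntry T i j)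
    {I J : Finset ℕ+} {t : ℕ+ → ℕ+ → ℂ} (ht0 : ∀ i j, ¬ (i ∈ I ∧ j ∈ J) → t i j = 0)
    (ht : ∀ v : ℕ+ → ℂ, ∑ i ∈ I, ‖∑ j ∈ J, t i j * v j‖ ^ 2 ≤ ∑ j ∈ J, ‖v j‖ ^ 2) :
    ‖∑ j ∈ J, ∑ i ∈ I, X i j * t i j‖ ^ 2 ≤ I.card * (‖Φ‖ ^ 2 * J.card) := by
  classical
  obtain ⟨T, hTn, hT⟩ := exists_operator_of_sum_le t (fun _ => J) 1 zero_le_one fun v s => by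
    have hz : ∀ i ∈ s, i ∉ s ∩ I → ‖∑ j ∈ J, t i j * v j‖ ^ 2 = 0 := fun i hi hi' => by
      rw [Finset.sum_eq_zero fun j _ => ?_]
      · simp
      · rw [ht0 i j fun h => hi' (Finset.mem_inter.2 ⟨hi, h.1⟩), zero_mul]
    rw [← Finset.sum_subset Finset.inter_subset_left hz, one_mul]
    calc _ ≤ ∑ i ∈ I, ‖∑ j ∈ J, t i j * v j‖ ^ 2 :=
          Finset.sum_le_sum_of_subset_of_nonneg Finset.inter_subset_right fun _ _ _ => by positivity
      _ ≤ ∑ j ∈ J, ‖v j‖ ^ 2 := ht v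
      _ ≤ _ := EllTwo.sum_sq_le_norm_sq v J
  have hTe : ∀ i j, matrixEntry T i j = t i j :=
    matrixEntry_eq_of_apply_eq hT fun i j hj => ht0 i j fun h => hj h.2
  set w : EllTwo := ∑ j ∈ J, lp.single 2 j (1 : ℂ) with hw
  have hwn : ‖w‖ ^ 2 = J.card := by
    have := lp.norm_sum_single (p := 2) (E := fun _ : ℕ+ => ℂ) (by norm_num) (fun _ => (1 : ℂ)) J
    simpa using this
  have hΦw : ∀ i, (Φ T w) i = ∑ j ∈ J, X i j * t i j := fun i => by
    rw [hw, map_sum, lp.coeFn_sum, Finset.sum_apply]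
    refine Finset.sum_congr rfl fun j _ => ?_
    rw [← hTe, ← hΦ]
    rfl
  have hn : ‖Φ T w‖ ≤ ‖Φ‖ * ‖w‖ := by
    calc ‖Φ T w‖ ≤ ‖Φ T‖ * ‖w‖ := (Φ T).le_opNorm w
      _ ≤ ‖Φ‖ * ‖w‖ := by
        gcongr
        exact (Φ.le_opNorm T).trans (mul_le_of_le_one_right (norm_nonneg _) hTn)
  calc ‖∑ j ∈ J, ∑ i ∈ I, X i j * t i j‖ ^ 2
      = ‖∑ i ∈ I, (Φ T w) i‖ ^ 2 := by
        rw [Finset.sum_comm]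
        simp only [hΦw]
    _ ≤ (∑ i ∈ I, ‖(Φ T w) i‖) ^ 2 := by
        gcongr
        exact norm_sum_le _ _
    _ ≤ I.card * ∑ i ∈ I, ‖(Φ T w) i‖ ^ 2 := sq_sum_le_card_mul_sum_sq
    _ ≤ I.card * (‖Φ‖ * ‖w‖) ^ 2 := by
        gcongr
        refine (EllTwo.sum_sq_le_norm_sq _ _).trans ?_
        gcongr
    _ = _ := by rw [mul_pow, hwn]

/-! ### Unimodular entries from additive characters modulo a prime. -/

/-- Orthogonality of characters: elements of Q below p have distinct residues, so only the diagonal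
terms survive the sum over θ. -/
theorem sum_norm_sq_sum_stdAddChar {p : ℕ} [Fact p.Prime] (Q : Finset ℕ+)
    (hQ : ∀ i ∈ Q, (i : ℕ) < p) {c : ZMod p} (hc : c ≠ 0) :
    ∑ θ : ZMod p, ‖∑ i ∈ Q, ZMod.stdAddChar (θ * (c * ((i : ℕ) : ZMod p)))‖ ^ 2 =
      (p : ℝ) * Q.card := by
  have hterm : ∀ θ : ZMod p,
      ((‖∑ i ∈ Q, ZMod.stdAddChar (θ * (c * ((i : ℕ) : ZMod p)))‖ ^ 2 : ℝ) : ℂ) =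
      ∑ i ∈ Q, ∑ i' ∈ Q,
        ZMod.stdAddChar (θ * (c * (((i' : ℕ) : ZMod p) - ((i : ℕ) : ZMod p)))) := fun θ => by
    rw [Complex.ofReal_pow, ← Complex.conj_mul', map_sum, Finset.sum_mul_sum]
    refine Finset.sum_congr rfl fun i _ => Finset.sum_congr rfl fun i' _ => ?_
    rw [← AddChar.map_neg_eq_conj, ← AddChar.map_add_eq_mul]
    congr 1
    ring
  apply Complex.ofReal_injective
  rw [Complex.ofReal_sum, Finset.sum_congr rfl fun θ _ => hterm θ, Finset.sum_comm]
  have hinner : ∀ i ∈ Q, ∑ θ : ZMod p, ∑ i' ∈ Q,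
      (ZMod.stdAddChar (θ * (c * (((i' : ℕ) : ZMod p) - ((i : ℕ) : ZMod p)))) : ℂ) = p := by
    intro i hi
    rw [Finset.sum_comm, Finset.sum_eq_single i]
    · rw [AddChar.sum_mulShift _ (ZMod.isPrimitive_stdAddChar p), if_pos (by simp), ZMod.card]
    · intro i' hi' hne
      rw [AddChar.sum_mulShift _ (ZMod.isPrimitive_stdAddChar p), if_neg, Nat.cast_zero]
      refine mul_ne_zero hc (sub_ne_zero.2 fun h => hne (PNat.coe_injective ?_))
      rwa [ZMod.natCast_eq_natCast_iff', Nat.mod_eq_of_lt (hQ i hi), Nat.mod_eq_of_lt (hQ i' hi')]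
        at h
    · exact fun h => absurd hi h
  rw [Finset.sum_congr rfl hinner, Finset.sum_const, nsmul_eq_mul]
  push_cast
  ring

open scoped Classical in
/-- A finite pattern with `n` entries in each row and at most `n` in each column carries
unimodular entries for which the fourth Schatten moment is at most `2 n² |I|`. -/
theorem exists_unimodular_fourth_moment_le (I J : Finset ℕ+) (P : ℕ+ → ℕ+ → Prop) (n : ℕ)
    (hrow : ∀ i ∈ I, (J.filter fun j => P i j).card = n)
    (hcol : ∀ j ∈ J, (I.filter fun i => P i j).card ≤ n) :
    ∃ u : ℕ+ → ℕ+ → ℂ, (∀ i j, ‖u i j‖ = 1) ∧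
      ∑ j ∈ J, ∑ j' ∈ J, ‖∑ i ∈ I, star (if P i j then u i j else 0) *
        (if P i j' then u i j' else 0)‖ ^ 2 ≤ 2 * (n : ℝ) ^ 2 * I.card := by
  -- The prime exceeds every index in I and J, so distinct indices stay distinct modulo p.
  obtain ⟨p, hp, hpp⟩ := Nat.exists_infinite_primes
    ((∑ i ∈ I, (i : ℕ)) + (∑ j ∈ J, (j : ℕ)) + 1)
  have : Fact p.Prime := ⟨hpp⟩
  have hI : ∀ i ∈ I, (i : ℕ) < p := fun i hi => by
    have := Finset.single_le_sum (f := fun i : ℕ+ => (i : ℕ)) (fun _ _ => Nat.zero_le _) hi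
    omega
  have hJ : ∀ j ∈ J, (j : ℕ) < p := fun j hj => by
    have := Finset.single_le_sum (f := fun i : ℕ+ => (i : ℕ)) (fun _ _ => Nat.zero_le _) hj
    omega
  let Q : ℕ+ → ℕ+ → Finset ℕ+ := fun j j' => I.filter fun i => P i j ∧ P i j'
  -- With the phase θij, columns j and j' have as inner product an exponential sum of frequency θ(j'
  -- - j); averaging over θ replaces random signs.
  let u : ZMod p → ℕ+ → ℕ+ → ℂ := fun θ i j =>
    ZMod.stdAddChar (θ * (((j : ℕ) : ZMod p) * ((i : ℕ) : ZMod p)))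
  have hu : ∀ θ i j, ‖u θ i j‖ = 1 := fun θ i j => AddChar.norm_apply _ _
  have hgram : ∀ θ j j', ∑ i ∈ I, star (if P i j then u θ i j else 0) *
      (if P i j' then u θ i j' else 0) = ∑ i ∈ Q j j', ZMod.stdAddChar
        (θ * ((((j' : ℕ) : ZMod p) - ((j : ℕ) : ZMod p)) * ((i : ℕ) : ZMod p))) := by
    intro θ j j'
    rw [Finset.sum_filter]
    refine Finset.sum_congr rfl fun i _ => ?_
    by_cases h : P i j <;> by_cases h' : P i j' <;> simp only [h, h', if_true, if_false, and_true,
      and_false, star_zero, zero_mul, mul_zero]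
    rw [RCLike.star_def, ← AddChar.map_neg_eq_conj, ← AddChar.map_add_eq_mul]
    congr 1
    ring
  have hQdiag : ∀ j, Q j j = I.filter fun i => P i j := fun j => by simp [Q]
  -- Diagonal pairs contribute |Q|² ≤ n|Q|, the others |Q| on average. Each kind totals at most
  -- n²|I|, whence the factor 2.
  have hpair : ∀ j ∈ J, ∀ j' ∈ J, ∑ θ : ZMod p, ‖∑ i ∈ Q j j', (ZMod.stdAddChar
        (θ * ((((j' : ℕ) : ZMod p) - ((j : ℕ) : ZMod p)) * ((i : ℕ) : ZMod p))) : ℂ)‖ ^ 2 ≤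
      (p : ℝ) * ((if j = j' then (n : ℝ) * (Q j j).card else 0) + (Q j j').card) := by
    intro j hj j' hj'
    by_cases h : j = j'
    · subst h
      have hc : ((Q j j).card : ℝ) ≤ n := by rw [hQdiag]; exact_mod_cast hcol j hj
      simp only [sub_self, zero_mul, mul_zero, AddChar.map_zero_eq_one, Finset.sum_const,
        nsmul_eq_mul, mul_one, Complex.norm_natCast, Finset.card_univ, ZMod.card, if_true]
      gcongr
      nlinarith [(Nat.cast_nonneg (Q j j).card : (0 : ℝ) ≤ _)]
    · rw [sum_norm_sq_sum_stdAddChar (Q j j') (fun i hi => hI i (Finset.mem_filter.1 hi).1),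
        if_neg h, zero_add]
      refine sub_ne_zero.2 fun h' => h (PNat.coe_injective ?_)
      rw [ZMod.natCast_eq_natCast_iff', Nat.mod_eq_of_lt (hJ j hj),
        Nat.mod_eq_of_lt (hJ j' hj')] at h'
      exact h'.symm
  have hcount1 : ∑ j ∈ J, ((Q j j).card : ℝ) = n * I.card := by
    have : ∑ j ∈ J, (Q j j).card = ∑ i ∈ I, (J.filter fun j => P i j).card := by
      simp only [hQdiag, Finset.card_filter]
      exact Finset.sum_comm
    rw [← Nat.cast_sum, this, Finset.sum_congr rfl hrow]
    simp [mul_comm]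
  have hcount2 : ∑ j ∈ J, ∑ j' ∈ J, ((Q j j').card : ℝ) = (n : ℝ) ^ 2 * I.card := by
    have : ∑ j ∈ J, ∑ j' ∈ J, (Q j j').card =
        ∑ i ∈ I, (J.filter fun j => P i j).card * (J.filter fun j => P i j).card := by
      simp only [Q, Finset.card_filter, Finset.sum_mul_sum]
      rw [Finset.sum_congr rfl fun j _ => Finset.sum_comm, Finset.sum_comm]
      refine Finset.sum_congr rfl fun i _ => Finset.sum_congr rfl fun j _ =>
        Finset.sum_congr rfl fun j' _ => ?_
      by_cases h : P i j <;> by_cases h' : P i j' <;> simp [h, h']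
    have hn : ∑ i ∈ I, (J.filter fun j => P i j).card * (J.filter fun j => P i j).card =
        ∑ _i ∈ I, n * n := Finset.sum_congr rfl fun i hi => by rw [hrow i hi]
    rw [hn, Finset.sum_const, smul_eq_mul] at this
    have h := congrArg (Nat.cast : ℕ → ℝ) this
    push_cast at h
    rw [h]
    ring
  obtain ⟨θ, -, hθ⟩ := Finset.exists_le_of_sum_le (s := (Finset.univ : Finset (ZMod p)))
    (f := fun θ => ∑ j ∈ J, ∑ j' ∈ J, ‖∑ i ∈ I, star (if P i j then u θ i j else 0) *
        (if P i j' then u θ i j' else 0)‖ ^ 2) (g := fun _ => 2 * (n : ℝ) ^ 2 * I.card)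
    Finset.univ_nonempty (by
      simp only [hgram]
      rw [Finset.sum_comm, Finset.sum_congr rfl fun j _ => Finset.sum_comm]
      calc _ ≤ ∑ j ∈ J, ∑ j' ∈ J,
            (p : ℝ) * ((if j = j' then (n : ℝ) * (Q j j).card else 0) + (Q j j').card) :=
            Finset.sum_le_sum fun j hj => Finset.sum_le_sum fun j' hj' => hpair j hj j' hj'
        _ = p * (n * (n * I.card) + (n : ℝ) ^ 2 * I.card) := by
            simp only [← Finset.mul_sum, Finset.sum_add_distrib, hcount2]
            rw [← hcount1, Finset.mul_sum]
            congr 2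
            refine Finset.sum_congr rfl fun j hj => ?_
            rw [Finset.sum_ite_eq, if_pos hj]
        _ ≤ _ := by
            apply le_of_eq
            rw [Finset.sum_const, Finset.card_univ, ZMod.card, nsmul_eq_mul]
            ring)
  exact ⟨u θ, hu θ, hθ⟩

/-! ### Dyadic counts and lacunary sets. -/

theorem mem_dyadicPart_iff {S : Set ℕ+} {k : ℕ} {s : ℕ+} :
    s ∈ dyadicPart S k ↔ s ∈ S ∧ Nat.clog 2 (s : ℕ) = k := by
  have hpos : 0 < (s : ℕ) := s.pos
  have h1 : ((s : ℕ) : ℝ) ≤ (2 : ℝ) ^ k ↔ Nat.clog 2 (s : ℕ) ≤ k := by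
    rw [Nat.clog_le_iff_le_pow (by norm_num)]
    exact_mod_cast Iff.rfl
  have h2 : (2 : ℝ) ^ ((k : ℤ) - 1) < ((s : ℕ) : ℝ) ↔ k ≤ Nat.clog 2 (s : ℕ) := by
    rcases k with _ | k
    · simp only [CharP.cast_eq_zero, zero_sub, zpow_neg, zpow_one, zero_le, iff_true]
      have : (1 : ℝ) ≤ ((s : ℕ) : ℝ) := by exact_mod_cast hpos
      linarith
    · have : (2 : ℝ) ^ (((k + 1 : ℕ) : ℤ) - 1) = ((2 ^ k : ℕ) : ℝ) := by
        push_cast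
        rw [add_sub_cancel_right, zpow_natCast]
      rw [this, Nat.cast_lt, Nat.succ_le_iff, Nat.lt_clog_iff_pow_lt (by norm_num)]
  unfold dyadicPart
  simp only [Set.mem_ofPred_eq, h1, h2]
  constructor
  · rintro ⟨h, h3, h4⟩
    exact ⟨h, le_antisymm h4 h3⟩
  · rintro ⟨h, rfl⟩
    exact ⟨h, le_rfl, le_rfl⟩

theorem finite_setOf_clog_eq (k : ℕ) : {s : ℕ+ | Nat.clog 2 (s : ℕ) = k}.Finite := by
  refine (Set.finite_Iic ((2 : ℕ+) ^ k)).subset ?_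
  rintro s rfl
  rw [Set.mem_Iic, ← PNat.coe_le_coe, PNat.pow_coe]
  exact Nat.le_pow_clog (by norm_num) _

theorem dyadicPart_finite (S : Set ℕ+) (k : ℕ) : (dyadicPart S k).Finite :=
  (finite_setOf_clog_eq k).subset fun _ hs => (mem_dyadicPart_iff.1 hs).2

theorem iSup_encard_lt_top_iff {ι : Type*} (A : ι → Set ℕ+) :
    (⨆ k, (A k).encard) < (⊤ : ℕ∞) ↔ ∃ K : ℕ, ∀ k, (A k).encard ≤ K := by
  constructor
  · intro h
    obtain ⟨K, hK⟩ := ENat.ne_top_iff_exists.1 h.ne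
    exact ⟨K, fun k => hK ▸ le_iSup (fun k => (A k).encard) k⟩
  · rintro ⟨K, hK⟩
    exact (iSup_le hK).trans_lt (ENat.natCast_lt_top K)

theorem isLacunary_of_two_mul_lt {L : Set ℕ+}
    (h : ∀ s ∈ L, ∀ t ∈ L, s < t → 2 * (s : ℕ) < t) : IsLacunary L := by
  refine ⟨2, by norm_num, fun s hs t ht hst _ => ?_⟩
  rw [lt_div_iff₀ (by exact_mod_cast s.pos)]
  exact_mod_cast h s hs t ht hst

theorem two_mul_lt_of_clog_add_two_le {s t : ℕ+}
    (h : Nat.clog 2 (s : ℕ) + 2 ≤ Nat.clog 2 (t : ℕ)) : 2 * (s : ℕ) < t := by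
  have h1 : 2 ^ (Nat.clog 2 (s : ℕ) + 1) < (t : ℕ) :=
    (Nat.lt_clog_iff_pow_lt (by norm_num)).1 (by omega)
  have h2 := Nat.le_pow_clog (b := 2) (by norm_num) (s : ℕ)
  rw [pow_succ] at h1
  omega

/-- The number of smaller elements of `S` in the same dyadic interval. -/
noncomputable def dyadicRank (S : Set ℕ+) (s : ℕ+) : ℕ :=
  (dyadicPart S (Nat.clog 2 (s : ℕ)) ∩ Set.Iio s).ncard

theorem dyadicRank_lt_of_lt {S : Set ℕ+} {s t : ℕ+} (hs : s ∈ S) (hst : s < t)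
    (h : Nat.clog 2 (s : ℕ) = Nat.clog 2 (t : ℕ)) : dyadicRank S s < dyadicRank S t := by
  unfold dyadicRank
  rw [h]
  refine Set.ncard_lt_ncard ⟨fun r hr => ⟨hr.1, lt_trans hr.2 hst⟩, fun hsub => ?_⟩
    ((dyadicPart_finite S _).inter_of_left _)
  exact lt_irrefl s (Set.mem_Iio.1 (hsub (a := s) ⟨mem_dyadicPart_iff.2 ⟨hs, h⟩, hst⟩).2)

theorem dyadicRank_lt {S : Set ℕ+} {s : ℕ+} (hs : s ∈ S) {K : ℕ}
    (hK : ∀ k, (dyadicPart S k).encard ≤ K) : dyadicRank S s < K := by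
  have h1 : (dyadicPart S (Nat.clog 2 (s : ℕ))).ncard ≤ K := by
    have := hK (Nat.clog 2 (s : ℕ))
    rw [← (dyadicPart_finite S _).cast_ncard_eq] at this
    exact_mod_cast this
  refine lt_of_lt_of_le (Set.ncard_lt_ncard ⟨Set.inter_subset_left, fun hsub => ?_⟩
    (dyadicPart_finite S _)) h1
  exact lt_irrefl s (Set.mem_Iio.1 (hsub (a := s) (mem_dyadicPart_iff.2 ⟨hs, rfl⟩)).2)

/-- Classes are indexed by rank within the dyadic interval and parity of the exponent. Equal rank
forces different intervals, and equal parity then makes the exponents differ by at least 2, so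
ratios exceed 2. -/
theorem exists_lacunary_cover_of_dyadic_bound {S : Set ℕ+} {K : ℕ}
    (hK : ∀ k, (dyadicPart S k).encard ≤ K) :
    ∃ (n : ℕ) (L : Fin n → Set ℕ+), (∀ m, IsLacunary (L m)) ∧ S = ⋃ m, L m := by
  refine ⟨2 * K, fun m => {s ∈ S | 2 * dyadicRank S s + Nat.clog 2 (s : ℕ) % 2 = m},
    fun m => isLacunary_of_two_mul_lt ?_, ?_⟩
  · rintro s ⟨hs, hsm⟩ t ⟨ht, htm⟩ hst
    apply two_mul_lt_of_clog_add_two_le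
    have hmono : Nat.clog 2 (s : ℕ) ≤ Nat.clog 2 (t : ℕ) :=
      Nat.clog_mono_right 2 (PNat.coe_le_coe _ _ |>.2 hst.le)
    have hne : Nat.clog 2 (s : ℕ) ≠ Nat.clog 2 (t : ℕ) := fun h => by
      have := dyadicRank_lt_of_lt hs hst h
      omega
    omega
  · ext s
    simp only [Set.mem_iUnion, Set.mem_ofPred_eq]
    constructor
    · intro hs
      have := dyadicRank_lt hs hK
      exact ⟨⟨2 * dyadicRank S s + Nat.clog 2 (s : ℕ) % 2, by omega⟩, hs, rfl⟩
    · rintro ⟨_, hs, _⟩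
      exact hs

/-- The gap ratios telescope: induction passes from t to its predecessor in L, the maximum of L ∩
[s, t). -/
theorem pow_ncard_mul_le_of_consecutive {L : Set ℕ+} {q : ℝ} (hq : 1 < q)
    (hL : ∀ s ∈ L, ∀ t ∈ L, s < t → (∀ r ∈ L, ¬ (s < r ∧ r < t)) →
      q < ((t : ℕ) : ℝ) / ((s : ℕ) : ℝ)) {s : ℕ+} (hs : s ∈ L) (t : ℕ+) (ht : t ∈ L)
    (hst : s ≤ t) : q ^ (L ∩ Set.Ico s t).ncard * ((s : ℕ) : ℝ) ≤ ((t : ℕ) : ℝ) := by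
  induction t using WellFoundedLT.induction with
  | ind t ih =>
    rcases hst.eq_or_lt with rfl | hlt
    · simp
    have hfin : (L ∩ Set.Ico s t).Finite := (Set.finite_Ico s t).inter_of_right _
    obtain ⟨r, hr, hmax⟩ := Set.exists_max_image _ id hfin ⟨s, hs, le_rfl, hlt⟩
    have hins : L ∩ Set.Ico s t = insert r (L ∩ Set.Ico s r) := by
      ext x
      simp only [Set.mem_inter_iff, Set.mem_Ico, Set.mem_insert_iff]
      constructor
      · intro hx
        rcases (hmax x hx).eq_or_lt with h | h
        · exact Or.inl h
        · exact Or.inr ⟨hx.1, hx.2.1, h⟩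
      · rintro (rfl | hx)
        · exact hr
        · exact ⟨hx.1, hx.2.1, hx.2.2.trans hr.2.2⟩
    have hcard : (L ∩ Set.Ico s t).ncard = (L ∩ Set.Ico s r).ncard + 1 := by
      rw [hins, Set.ncard_insert_of_notMem (fun h => lt_irrefl _ h.2.2)
        ((Set.finite_Ico s r).inter_of_right _)]
    have h1 := ih r hr.2.2 hr.1 hr.2.1
    have h2 := hL r hr.1 t ht hr.2.2 fun x hx hxx =>
      not_lt_of_ge (hmax x ⟨hx, hr.2.1.trans hxx.1.le, hxx.2⟩) hxx.1
    rw [lt_div_iff₀ (by exact_mod_cast r.pos)] at h2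
    rw [hcard, pow_succ]
    calc q ^ (L ∩ Set.Ico s r).ncard * q * ((s : ℕ) : ℝ)
        = q * (q ^ (L ∩ Set.Ico s r).ncard * ((s : ℕ) : ℝ)) := by ring
      _ ≤ q * ((r : ℕ) : ℝ) := by gcongr
      _ ≤ _ := h2.le

theorem IsLacunary.exists_dyadic_bound {L : Set ℕ+} (hL : IsLacunary L) :
    ∃ K : ℕ, ∀ k, (dyadicPart L k).encard ≤ K := by
  obtain ⟨q, hq, hL⟩ := hL
  -- Two points of one dyadic interval have ratio at most 2 < q^m, so m gaps between its extremes
  -- are impossible.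
  obtain ⟨m, hm⟩ := pow_unbounded_of_one_lt 2 hq
  refine ⟨m, fun k => ?_⟩
  have hfin := dyadicPart_finite L k
  rw [← hfin.cast_ncard_eq, Nat.cast_le]
  rcases (dyadicPart L k).eq_empty_or_nonempty with h0 | hne
  · simp [h0]
  obtain ⟨s, hs, hmin⟩ := Set.exists_min_image _ id hfin hne
  obtain ⟨t, ht, hmax⟩ := Set.exists_max_image _ id hfin hne
  by_contra! hlt
  have hsub : dyadicPart L k ⊆ insert t (L ∩ Set.Ico s t) := fun x hx => by
    rcases (hmax x hx).eq_or_lt with h | h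
    · exact Or.inl h
    · exact Or.inr ⟨hx.1, hmin x hx, h⟩
  have hcard := (Set.ncard_le_ncard hsub
    (((Set.finite_Ico s t).inter_of_right _).insert t)).trans (Set.ncard_insert_le _ _)
  have h1 := pow_ncard_mul_le_of_consecutive hq hL hs.1 t ht.1 (hmin t ht)
  have h2 : q ^ m ≤ q ^ (L ∩ Set.Ico s t).ncard := pow_le_pow_right₀ hq.le (by omega)
  have h3 : ((t : ℕ) : ℝ) ≤ 2 * ((s : ℕ) : ℝ) := by
    have h4 := ht.2.2
    have h5 := hs.2.1
    rw [zpow_sub₀ (by norm_num), zpow_natCast, zpow_one] at h5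
    linarith
  have hs0 : (0 : ℝ) < ((s : ℕ) : ℝ) := by exact_mod_cast s.pos
  nlinarith

theorem exists_dyadic_bound_of_lacunary_cover {S : Set ℕ+} {n : ℕ} {L : Fin n → Set ℕ+}
    (hL : ∀ m, IsLacunary (L m)) (hS : S = ⋃ m, L m) :
    ∃ K : ℕ, ∀ k, (dyadicPart S k).encard ≤ K := by
  choose K hK using fun m => (hL m).exists_dyadic_bound
  refine ⟨∑ m, K m, fun k => ?_⟩
  have hsub : dyadicPart S k ⊆ ⋃ m, dyadicPart (L m) k := by
    subst hS
    rintro s ⟨hs, hs'⟩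
    obtain ⟨m, hm⟩ := Set.mem_iUnion.1 hs
    exact Set.mem_iUnion.2 ⟨m, hm, hs'⟩
  refine (Set.encard_le_encard hsub).trans ((Set.encard_iUnion_le_of_fintype _).trans ?_)
  rw [Nat.cast_sum]
  exact Finset.sum_le_sum fun m _ => hK m k

/-! ### Splitting the Hankel pattern along the diagonal. -/

theorem clog_add_of_le {i j : ℕ+} (h : j ≤ i) :
    Nat.clog 2 ((i + j : ℕ+) : ℕ) = Nat.clog 2 (i : ℕ) ∨
      Nat.clog 2 ((i + j : ℕ+) : ℕ) = Nat.clog 2 (i : ℕ) + 1 := by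
  have h0 : (j : ℕ) ≤ i := h
  have h1 : Nat.clog 2 (i : ℕ) ≤ Nat.clog 2 ((i + j : ℕ+) : ℕ) :=
    Nat.clog_mono_right 2 (by rw [PNat.add_coe]; omega)
  have h2 : Nat.clog 2 ((i + j : ℕ+) : ℕ) ≤ Nat.clog 2 (i : ℕ) + 1 := by
    rw [Nat.clog_le_iff_le_pow (by norm_num), pow_succ, PNat.add_coe]
    have := Nat.le_pow_clog (b := 2) (by norm_num) (i : ℕ)
    omega
  omega

theorem encard_setOf_le_add_mem {S : Set ℕ+} {K : ℕ}
    (hK : ∀ k, (dyadicPart S k).encard ≤ K) (i : ℕ+) :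
    {j : ℕ+ | i + j ∈ S ∧ j ≤ i}.encard ≤ (2 * K : ℕ) := by
  rw [← (add_right_injective i).encard_image]
  have hsub : (fun j => i + j) '' {j : ℕ+ | i + j ∈ S ∧ j ≤ i} ⊆
      dyadicPart S (Nat.clog 2 (i : ℕ)) ∪ dyadicPart S (Nat.clog 2 (i : ℕ) + 1) := by
    rintro _ ⟨j, ⟨hj, hji⟩, rfl⟩
    rcases clog_add_of_le hji with h | h
    · exact Or.inl (mem_dyadicPart_iff.2 ⟨hj, h⟩)
    · exact Or.inr (mem_dyadicPart_iff.2 ⟨hj, h⟩)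
  refine (Set.encard_le_encard hsub).trans ((Set.encard_union_le _ _).trans ?_)
  rw [two_mul, Nat.cast_add]
  exact add_le_add (hK _) (hK _)

theorem hankelPattern_eq_union_of_dyadic_bound {S : Set ℕ+} {K : ℕ}
    (hK : ∀ k, (dyadicPart S k).encard ≤ K) :
    ∃ R C : Set (ℕ+ × ℕ+), IsRowFinite R ∧ IsColumnFinite C ∧ hankelPattern S = R ∪ C := by
  refine ⟨{p | p.1 + p.2 ∈ S ∧ p.2 ≤ p.1}, {p | p.2 + p.1 ∈ S ∧ p.1 ≤ p.2},
    ⟨2 * K, fun i => encard_setOf_le_add_mem hK i⟩,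
    ⟨2 * K, fun j => encard_setOf_le_add_mem hK j⟩, ?_⟩
  ext p
  simp only [hankelPattern, Set.mem_ofPred_eq, Set.mem_union, add_comm p.2 p.1, ← and_or_left,
    le_total, and_true]

/-! ### Necessity of the dyadic bound. -/

open scoped Classical in
theorem card_le_norm_sq_of_schur {X : ℕ+ → ℕ+ → ℂ}
    {Φ : (EllTwo →L[ℂ] EllTwo) →L[ℂ] (EllTwo →L[ℂ] EllTwo)}
    (hΦ : ∀ (T : EllTwo →L[ℂ] EllTwo) (i j : ℕ+),
      matrixEntry (Φ T) i j = X i j * matrixEntry T i j)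
    {I J : Finset ℕ+} (hI : I.Nonempty) (hIJ : J.card ≤ 4 * I.card) {P : ℕ+ → ℕ+ → Prop} {n : ℕ}
    (hrow : ∀ i ∈ I, (J.filter fun j => P i j).card = n) {u : ℕ+ → ℕ+ → ℂ}
    (hu : ∀ i j, ‖u i j‖ = 1)
    (hu4 : ∑ j ∈ J, ∑ j' ∈ J, ‖∑ i ∈ I, star (if P i j then u i j else 0) *
        (if P i j' then u i j' else 0)‖ ^ 2 ≤ 2 * (n : ℝ) ^ 2 * I.card)
    (hX : ∀ i ∈ I, ∀ j ∈ J, X i j = star (if P i j then u i j else 0)) :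
    (n : ℝ) ≤ 16 * ‖Φ‖ ^ 2 := by
  rcases Nat.eq_zero_or_pos n with rfl | hn
  · rw [Nat.cast_zero]
    positivity
  have hn0 : (0 : ℝ) < n := by exact_mod_cast hn
  have hN0 : (0 : ℝ) < I.card := by exact_mod_cast hI.card_pos
  -- For μ = 2√n the second and fourth moments give 4√n(|I|/4 - |I|/8) = √n|I|/2.
  have hμ : 0 < 2 * √(n : ℝ) := by positivity
  obtain ⟨t, ht0, ht, hpair⟩ := exists_contraction_pairing_ge I J
    (fun i j => if P i j then u i j else 0) hμ
  have h2 : ∑ j ∈ J, ∑ i ∈ I, ‖if P i j then u i j else 0‖ ^ 2 = (n : ℝ) * I.card := by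
    have : ∀ i j, ‖if P i j then u i j else 0‖ ^ 2 = if P i j then (1 : ℝ) else 0 := fun i j => by
      split_ifs <;> simp [hu]
    simp only [this]
    rw [Finset.sum_comm, Finset.sum_congr rfl fun i hi => by
      rw [Finset.sum_boole, hrow i hi], Finset.sum_const, nsmul_eq_mul, mul_comm]
  have hX' : ∑ j ∈ J, ∑ i ∈ I, star (if P i j then u i j else 0) * t i j =
      ∑ j ∈ J, ∑ i ∈ I, X i j * t i j :=
    Finset.sum_congr rfl fun j hj => Finset.sum_congr rfl fun i hi => by rw [hX i hi j hj]
  have hs : √(n : ℝ) ^ 2 = n := Real.sq_sqrt hn0.le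
  have hlow : √(n : ℝ) * I.card / 2 ≤ ‖∑ j ∈ J, ∑ i ∈ I, X i j * t i j‖ := by
    rw [← hX']
    refine le_trans ?_ (hpair.trans (Complex.re_le_norm _))
    rw [h2]
    calc √(n : ℝ) * I.card / 2 = 2 * (2 * √(n : ℝ)) * ((n : ℝ) * I.card / (2 * √(n : ℝ)) ^ 2 -
          2 * (n : ℝ) ^ 2 * I.card / (2 * √(n : ℝ)) ^ 4) := by
          have e4 : (2 * √(n : ℝ)) ^ 4 = 16 * (n : ℝ) ^ 2 := by
            calc (2 * √(n : ℝ)) ^ 4 = 16 * (√(n : ℝ) ^ 2) ^ 2 := by ring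
              _ = _ := by rw [hs]
          rw [e4, mul_pow, hs]
          field_simp
          norm_num
      _ ≤ _ := by gcongr
  have hup := norm_sum_schur_le hΦ ht0 ht
  have hJ : (J.card : ℝ) ≤ 4 * I.card := by exact_mod_cast hIJ
  have h5 : (√(n : ℝ) * I.card / 2) ^ 2 ≤ I.card * (‖Φ‖ ^ 2 * (4 * I.card)) := by
    refine (pow_le_pow_left₀ (by positivity) hlow 2).trans (hup.trans ?_)
    gcongr
  rw [div_pow, mul_pow, hs] at h5
  have h6 : (n : ℝ) * (I.card : ℝ) ^ 2 ≤ 16 * ‖Φ‖ ^ 2 * (I.card : ℝ) ^ 2 := by linarith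
  exact le_of_mul_le_mul_right h6 (by positivity)

/-- The positive integers in `(2^(m-1), 2^m]`. -/
noncomputable def dyadicBlock (m : ℕ) : Finset ℕ+ := (finite_setOf_clog_eq m).toFinset

theorem mem_dyadicBlock {m : ℕ} {i : ℕ+} : i ∈ dyadicBlock m ↔ Nat.clog 2 (i : ℕ) = m := by
  simp [dyadicBlock]

theorem two_pow_le_two_mul_card_dyadicBlock (m : ℕ) : 2 ^ m ≤ 2 * (dyadicBlock m).card := by
  rcases m with _ | k
  · have : (1 : ℕ+) ∈ dyadicBlock 0 := mem_dyadicBlock.2 (by simp)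
    have := Finset.card_pos.2 ⟨_, this⟩
    omega
  · have hsub : Finset.Ioc ((2 : ℕ+) ^ k) (2 ^ (k + 1)) ⊆
        dyadicBlock (k + 1) := fun i hi => by
      rw [Finset.mem_Ioc, ← PNat.coe_lt_coe, ← PNat.coe_le_coe, PNat.pow_coe, PNat.pow_coe,
        PNat.val_ofNat] at hi
      have h1 : k < Nat.clog 2 (i : ℕ) := (Nat.lt_clog_iff_pow_lt (by norm_num)).2 hi.1
      have h2 : Nat.clog 2 (i : ℕ) ≤ k + 1 := (Nat.clog_le_iff_le_pow (by norm_num)).2 hi.2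
      exact mem_dyadicBlock.2 (by omega)
    have := Finset.card_le_card hsub
    rw [PNat.card_Ioc] at this
    rw [PNat.pow_coe, PNat.pow_coe, PNat.val_ofNat, pow_succ] at this
    rw [pow_succ]
    omega

-- Since i ≤ 2^m < s ≤ 2^(m+1), each s - i is a valid column index, so every row of the block is
-- full.
open scoped Classical in
theorem card_filter_add_mem_dyadicPart (S : Set ℕ+) {m : ℕ} {i : ℕ+} (hi : i ∈ dyadicBlock m) :
    ((Finset.Icc 1 ((2 : ℕ+) ^ (m + 1))).filter
      fun j => i + j ∈ dyadicPart S (m + 1)).card = (dyadicPart S (m + 1)).ncard := by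
  rw [← Set.ncard_coe_finset, ← Set.ncard_image_of_injective _ (add_right_injective i)]
  congr 1
  ext s
  simp only [Set.mem_image, SetLike.mem_coe, Finset.mem_filter, Finset.mem_Icc]
  constructor
  · rintro ⟨j, ⟨_, hj⟩, rfl⟩
    exact hj
  · intro hs
    have hc := (mem_dyadicPart_iff.1 hs).2
    have h1 : 2 ^ m < (s : ℕ) := (Nat.lt_clog_iff_pow_lt (by norm_num)).1 (by omega)
    have h2 : (s : ℕ) ≤ 2 ^ (m + 1) := (Nat.clog_le_iff_le_pow (by norm_num)).1 hc.le
    have h3 : (i : ℕ) ≤ 2 ^ m :=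
      (Nat.clog_le_iff_le_pow (by norm_num)).1 (mem_dyadicBlock.1 hi).le
    have his : i < s := (PNat.coe_lt_coe _ _).1 (by omega)
    have hadd := PNat.add_sub_of_lt his
    refine ⟨s - i, ⟨⟨one_le, ?_⟩, ?_⟩, hadd⟩
    · rw [← PNat.coe_le_coe, PNat.sub_coe, if_pos his, PNat.pow_coe, PNat.val_ofNat]
      exact (Nat.sub_le _ _).trans h2
    · rwa [hadd]

open scoped Classical in
theorem card_filter_add_mem_le (I : Finset ℕ+) (j : ℕ+) {D : Set ℕ+} (hD : D.Finite) :
    (I.filter fun i => i + j ∈ D).card ≤ D.ncard := by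
  rw [← Set.ncard_coe_finset]
  refine Set.ncard_le_ncard_of_injOn (fun i => i + j) (fun i hi => ?_)
    (add_left_injective j).injOn hD
  exact (Finset.mem_filter.1 (Finset.mem_coe.1 hi)).2

theorem IsSchurBounded.exists_dyadic_bound {S : Set ℕ+} (h : IsSchurBounded (hankelPattern S)) :
    ∃ K : ℕ, ∀ k, (dyadicPart S k).encard ≤ K := by
  classical
  choose u hu hu4 using fun m : ℕ => exists_unimodular_fourth_moment_le (dyadicBlock m)
    (Finset.Icc 1 ((2 : ℕ+) ^ (m + 1))) (fun i j => i + j ∈ dyadicPart S (m + 1))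
    (dyadicPart S (m + 1)).ncard (fun i hi => card_filter_add_mem_dyadicPart S hi)
    (fun j _ => card_filter_add_mem_le _ j (dyadicPart_finite S _))
  -- The row index determines its block, so all the blocks fit into one matrix.
  let X : ℕ+ → ℕ+ → ℂ := fun i j => star
    (if i + j ∈ dyadicPart S (Nat.clog 2 (i : ℕ) + 1) then u (Nat.clog 2 (i : ℕ)) i j else 0)
  obtain ⟨Φ, hΦ⟩ := h X
    (fun p hp => by
      by_contra hpS
      exact hp (by
        have : p.1 + p.2 ∉ dyadicPart S (Nat.clog 2 (p.1 : ℕ) + 1) := fun h' => hpS h'.1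
        simp [X, this]))
    (fun i j => by
      simp only [X, norm_star]
      split_ifs
      · exact (hu _ i j).le
      · simp)
  have hbound : ∀ m, (dyadicPart S (m + 1)).encard ≤ (⌈16 * ‖Φ‖ ^ 2⌉₊ + 1 : ℕ) := by
    intro m
    have hcard := two_pow_le_two_mul_card_dyadicBlock m
    have hne : (dyadicBlock m).Nonempty := Finset.card_pos.1 (by
      have : 0 < 2 ^ m := by positivity
      omega)
    have hle := card_le_norm_sq_of_schur hΦ hne (J := Finset.Icc 1 ((2 : ℕ+) ^ (m + 1)))
      (by
        rw [PNat.card_Icc, PNat.pow_coe, PNat.val_ofNat, PNat.one_coe, pow_succ]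
        omega)
      (fun i hi => card_filter_add_mem_dyadicPart S hi) (hu m) (hu4 m)
      (fun i hi j _ => by simp only [X, mem_dyadicBlock.1 hi])
    rw [← (dyadicPart_finite S _).cast_ncard_eq, Nat.cast_le]
    have := hle.trans (Nat.le_ceil _)
    have : (dyadicPart S (m + 1)).ncard ≤ ⌈16 * ‖Φ‖ ^ 2⌉₊ := by exact_mod_cast this
    omega
  refine ⟨⌈16 * ‖Φ‖ ^ 2⌉₊ + 1, fun k => ?_⟩
  -- The blocks reach only the intervals with k ≥ 1; for k = 0 only the point 1 is possible, which
  -- the added 1 covers.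
  rcases k with _ | m
  · have hsub : dyadicPart S 0 ⊆ {1} := fun s hs => by
      have h1 := (Nat.clog_le_iff_le_pow (b := 2) (by norm_num)).1 (mem_dyadicPart_iff.1 hs).2.le
      exact PNat.coe_injective (le_antisymm h1 s.pos)
    refine (Set.encard_le_encard hsub).trans ?_
    rw [Set.encard_singleton]
    exact_mod_cast Nat.le_add_left 1 _
  · exact hbound m

theorem proposition3p1 (S : Set ℕ+) :
    List.TFAE [
      IsSchurBounded (hankelPattern S),
      ∃ R C : Set (ℕ+ × ℕ+), IsRowFinite R ∧ IsColumnFinite C ∧ hankelPattern S = R ∪ C,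
      (⨆ k : ℕ, (dyadicPart S k).encard) < (⊤ : ℕ∞),
      ∃ (n : ℕ) (L : Fin n → Set ℕ+), (∀ m, IsLacunary (L m)) ∧ S = ⋃ m, L m] := by
  rw [iSup_encard_lt_top_iff]
  tfae_have 1 → 3 := fun h => h.exists_dyadic_bound
  tfae_have 3 → 2 := fun ⟨_, hK⟩ => hankelPattern_eq_union_of_dyadic_bound hK
  tfae_have 2 → 1 := fun ⟨_, _, hR, hC, h⟩ => h ▸ isSchurBounded_union hR hC
  tfae_have 3 → 4 := fun ⟨_, hK⟩ => exists_lacunary_cover_of_dyadic_bound hK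
  tfae_have 4 → 3 := fun ⟨_, _, hL, hS⟩ => exists_dyadic_bound_of_lacunary_cover hL hS
  tfae_finish
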